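/- Let $r\ge 1$, $s,n\ge 0$ be integers, let $X=\{x_{ijk}: i\le r,\ j\le s,\ k\le n\}$, ordered lexicographically as $x_{111},x_{112},\dots,x_{rsn}$, and let $\mathbb F_2[X]$ be the polynomial ring over $\mathbb F_2$. Fix a term order. For an ideal $I\subseteq\mathbb F_2[X]$ let $\mathrm{HF}_{\mathbb F_2[X]/I}(m)$ denote the number of standard monomials of $I$ of degree $m$, i.e. of monomials of total degree $m$ that do not lie in the initial ideal of $I$. Let $I_{r,s,n}$ be the (radical, zero-dimensional) ideal of $r\times s$ partial Latin rectangles on $n$ symbols, $$I_{r,s,n}=\langle x_{ijk}x_{i'jk}\ (i\ne i'),\ x_{ijk}x_{ij'k}\ (j\ne j'),\ x_{ijk}x_{ijk'}\ (k\ne k'),\ x_{ijk}(x_{ijk}-1)\rangle ,$$ and for $i\le r$ let $$I^{(i)}_{r,s,n}=\langle x_{ijk}x_{ij'k}\ (j\ne j'),\ x_{ijk}x_{ijk'}\ (k\ne k'),\ x_{ijk}(x_{ijk}-1)\rangle$$ be the ideal of row $i$ (here $j,j'\le s$ and $k,k'\le n$). The class of a polynomial is the least $c$ such that it only involves the first $c$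 variables of $X$; a triangular system is a finite sequence of polynomials of strictly increasing class. Let $T_1,\dots,T_t$ be triangular systems of polynomials in the first-row variables $x_{1jk}$ such that every member of every $T_l$ is of the form $x_{1jk}$, or of the form $x_{1jk}-1$, or an element of $I^{(1)}_{r,s,n}$, and such that the affine varieties over $\mathbb F_2$ of the ideals $$J_{1,l}=I^{(1)}_{r,s,n}+\langle T_l\rangle\qquad(1\le l\le t)$$ are pairwise disjoint with union $\mathcal V(I^{(1)}_{r,s,n})$. The generators of $J_{1,l}$ are those of $I^{(1)}_{r,s,n}$ listed above and the members of $T_l$. For $i\le r$ let $J_{i,l}$ be the ideal generated by the generators of $J_{1,l}$ after replacing each variable $x_{1jk}$ by $x_{ijk}$. For $(t_1,\dots,t_r)\in[t]^r$, where $[t]=\{1,\dots,t\}$, put $$K_{t_1\dots t_r}=J_{1,t_1}+\dots+J_{r,t_r}+\langle x_{ijk}x_{i'jk}: i\ne i'\rangle ,$$ and let $m_{t_1\dots t_r}$ be the number of generators of $K_{t_1\dots t_r}$ of the form $x_{ijk}-1$. Then, for every integer $m\ge 0$, $$\mathrm{HF}_{\mathbb F_2[X]/I_{r,s,n}}(m)=\sum_{\substack{(t_1,\dots,t_r)\in[t]^r\\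 m_{t_1\dots t_r}\le m}}\mathrm{HF}_{\mathbb F_2[X]/K_{t_1\dots t_r}}\bigl(m-m_{t_1\dots t_r}\bigr).$$ -/

import Mathlib

open MvPolynomial

namespace LatinRect

noncomputable section

/-! ### Term orders, standard monomials, Hilbert functions, triangular systems -/

/-- The initial ideal of `I`: the ideal generated by the leading monomials of the nonzero
elements of `I`, with respect to the term order `ord`. -/
def initialIdeal {σ K : Type*} [Field K] (ord : MonomialOrder σ) (I : Ideal (MvPolynomial σ K)) :
    Ideal (MvPolynomial σ K) :=
  Ideal.span {q | ∃ f ∈ I, f ≠ 0 ∧ q = monomial (ord.degree f) (1 : K)}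

/-- The exponents of the standard monomials of `I` of total degree `m`, that is, of the monomials
of degree `m` that do not lie in the initial ideal of `I`. -/
def standardMonomials {σ K : Type*} [Field K] (ord : MonomialOrder σ)
    (I : Ideal (MvPolynomial σ K)) (m : ℕ) : Set (σ →₀ ℕ) :=
  {a | a.degree = m ∧ monomial a (1 : K) ∉ initialIdeal ord I}

/-- The Hilbert function of `K[X]/I`: the number of standard monomials of `I` of degree `m`. -/
def hilbertFunction {σ K : Type*} [Field K] (ord : MonomialOrder σ)
    (I : Ideal (MvPolynomial σ K)) (m : ℕ) : ℕ :=
  (standardMonomials ord I m).ncard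

/-- The class of a polynomial in variables listed in the order given by `pos` (`pos v` is the
zero-based position of the variable `v`): the least `c` such that `p` is a polynomial in the
first `c` variables. -/
def polyClass {σ K : Type*} [Field K] (pos : σ → ℕ) (p : MvPolynomial σ K) : ℕ :=
  sInf {c | p ∈ supported K {v | pos v < c}}

/-- A triangular system: a finite sequence of polynomials of strictly increasing class. -/
def IsTriangularSystem {σ K : Type*} [Field K] (pos : σ → ℕ) (T : List (MvPolynomial σ K)) : Prop :=
  T.Pairwise fun p q => polyClass pos p < polyClass pos q

/-! ### The ideals of partial Latin rectangles -/

variable (r s n : ℕ)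

/-- Indices `(i, j, k)` (row, column, symbol) of the variables `x_{ijk}`. -/
abbrev Idx : Type := Fin r × Fin s × Fin n

/-- The polynomial ring `𝔽₂[x_{111}, …, x_{rsn}]`. -/
abbrev Poly : Type := MvPolynomial (Idx r s n) (ZMod 2)

/-- Position of `x_{ijk}` in the list `x_{111}, x_{112}, …, x_{rsn}` (lexicographic order). -/
def varPos (v : Idx r s n) : ℕ := (v.1 : ℕ) * (s * n) + (v.2.1 : ℕ) * n + (v.2.2 : ℕ)

/-- Generators of the ideal of row `i`: no symbol twice in the row, no two symbols in a cell of
the row, and the equations `x(x - 1) = 0`. -/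
def rowGens (i : Fin r) : Set (Poly r s n) :=
  {p | ∃ (j j' : Fin s) (k : Fin n), j ≠ j' ∧ p = X (i, j, k) * X (i, j', k)} ∪
  {p | ∃ (j : Fin s) (k k' : Fin n), k ≠ k' ∧ p = X (i, j, k) * X (i, j, k')} ∪
  {p | ∃ (j : Fin s) (k : Fin n), p = X (i, j, k) * (X (i, j, k) - 1)}

/-- The monomials `x_{ijk} x_{i'jk}` with `i ≠ i'`: no symbol twice in a column. -/
def colGens : Set (Poly r s n) :=
  {p | ∃ (i i' : Fin r) (j : Fin s) (k : Fin n), i ≠ i' ∧ p = X (i, j, k) * X (i', j, k)}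

/-- The ideal `I_{r,s,n}` of `r × s` partial Latin rectangles on `n` symbols. -/
def plrIdeal : Ideal (Poly r s n) :=
  Ideal.span ((⋃ i, rowGens r s n i) ∪ colGens r s n)

/-- The ideal `I^{(i)}_{r,s,n}` of row `i`. -/
def rowIdeal (i : Fin r) : Ideal (Poly r s n) := Ideal.span (rowGens r s n i)

variable {r s n}

/-- Replace every variable by the variable with the same column and symbol in row `i`; on
polynomials in the first-row variables this replaces `x_{1jk}` by `x_{ijk}`. -/
def toRow (i : Fin r) : Poly r s n →ₐ[ZMod 2] Poly r s n :=
  rename fun v => (i, v.2)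

/-- Generators of `J_{1,l}`: those of `I^{(1)}_{r,s,n}` together with the system `T l`. -/
def firstRowGens [NeZero r] {t : ℕ} (T : Fin t → List (Poly r s n)) (l : Fin t) :
    Set (Poly r s n) :=
  rowGens r s n 0 ∪ {p | p ∈ T l}

/-- The ideal `J_{1,l}`. -/
def firstRowPart [NeZero r] {t : ℕ} (T : Fin t → List (Poly r s n)) (l : Fin t) :
    Ideal (Poly r s n) :=
  Ideal.span (firstRowGens T l)

/-- `T 0, …, T (t-1)` is a triangular decomposition of the first-row ideal. Each `T l` is a
triangular system in the first-row variables, all of whose members are of the form `x_{1jk}` or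
`x_{1jk} - 1` or already lie in `I^{(1)}_{r,s,n}`, and the affine varieties of the ideals
`J_{1,l}` partition the affine variety of `I^{(1)}_{r,s,n}`. -/
structure IsTriangularDecomposition [NeZero r] {t : ℕ} (T : Fin t → List (Poly r s n)) : Prop where
  triangular : ∀ l, IsTriangularSystem (varPos r s n) (T l)
  firstRow : ∀ l, ∀ p ∈ T l, p ∈ supported (ZMod 2) {v : Idx r s n | v.1 = 0}
  form : ∀ l, ∀ p ∈ T l,
    (∃ v : Idx r s n, p = X v) ∨ (∃ v : Idx r s n, p = X v - 1) ∨ p ∈ rowIdeal r s n 0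
  disjoint : Pairwise fun l l' =>
    Disjoint (zeroLocus (ZMod 2) (firstRowPart T l)) (zeroLocus (ZMod 2) (firstRowPart T l'))
  covers : ⋃ l, zeroLocus (ZMod 2) (firstRowPart T l) = zeroLocus (ZMod 2) (rowIdeal r s n 0)

/-- Generators of `J_{i,l}`: those of `J_{1,l}` with `x_{1jk}` replaced by `x_{ijk}`. -/
def partGens [NeZero r] {t : ℕ} (T : Fin t → List (Poly r s n)) (i : Fin r) (l : Fin t) :
    Set (Poly r s n) :=
  toRow i '' firstRowGens T l

/-- The ideal `J_{i,l}`. -/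
def part [NeZero r] {t : ℕ} (T : Fin t → List (Poly r s n)) (i : Fin r) (l : Fin t) :
    Ideal (Poly r s n) :=
  Ideal.span (partGens T i l)

/-- The ideal `K_{τ(1),…,τ(r)} = J_{1,τ(1)} + ⋯ + J_{r,τ(r)} + ⟨x_{ijk} x_{i'jk}⟩`. -/
def tupleIdeal [NeZero r] {t : ℕ} (T : Fin t → List (Poly r s n)) (τ : Fin r → Fin t) :
    Ideal (Poly r s n) :=
  (∑ i, part T i (τ i)) + Ideal.span (colGens r s n)

/-- The number `m_{τ(1),…,τ(r)}` of generators of `K_{τ(1),…,τ(r)}` of the form `x_{ijk} - 1`. -/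
def numOnes [NeZero r] {t : ℕ} (T : Fin t → List (Poly r s n)) (τ : Fin r → Fin t) : ℕ :=
  {p | p ∈ (⋃ i, partGens T i (τ i)) ∪ colGens r s n ∧ ∃ v : Idx r s n, p = X v - 1}.ncard

end

end LatinRect

/-! Over `𝔽₂` a point is a set `P` of variables equal to `1`. Suppose an ideal is generated by
monomials `x_v` and `x_v x_w` (`v ≠ w`), all `x_v(x_v - 1)`, and `x_v - 1` for `v ∈ O`. Whatever the
term order, its standard monomials are the squarefree ones whose support `A` is disjoint from `O`
and for which `A ∪ O` is a zero (`hilbertFunction_eq_ncard`). Hence its Hilbert function at `m`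
counts zeros with `m + |O|` ones. Both `I` and every `K_τ` have such generators, once the redundant
members of the systems are dropped. The claim thus becomes a count of partial Latin rectangles with
`m` entries: applying the decomposition to each row separately places each of them in the variety of
exactly one `K_τ` (`existsUnique_mem_zeroLocus_tupleIdeal`). -/

namespace LatinRect

/-! ### Standard monomials and zeros over `𝔽₂` -/

section

variable {σ : Type*}

theorem initialIdeal_eq_span_image {K : Type*} [Field K] (ord : MonomialOrder σ)
    (I : Ideal (MvPolynomial σ K)) :
    initialIdeal ord I =
      Ideal.span ((fun b => monomial b (1 : K)) '' {b | ∃ f ∈ I, f ≠ 0 ∧ ord.degree f = b}) := by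
  unfold initialIdeal
  congr 1
  ext q
  constructor
  · rintro ⟨f, hf, h0, rfl⟩
    exact ⟨_, ⟨f, hf, h0, rfl⟩, rfl⟩
  · rintro ⟨_, ⟨f, hf, h0, rfl⟩, rfl⟩
    exact ⟨f, hf, h0, rfl⟩

theorem monomial_mem_initialIdeal {K : Type*} [Field K] {ord : MonomialOrder σ}
    {I : Ideal (MvPolynomial σ K)} {a : σ →₀ ℕ} :
    monomial a (1 : K) ∈ initialIdeal ord I ↔ ∃ f ∈ I, f ≠ 0 ∧ ord.degree f ≤ a := by
  classical
  rw [initialIdeal_eq_span_image, mem_ideal_span_monomial_image]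
  constructor
  · intro h
    obtain ⟨_, ⟨f, hf, h0, rfl⟩, hle⟩ := h a (by simp)
    exact ⟨f, hf, h0, hle⟩
  · rintro ⟨f, hf, h0, hle⟩ b hb
    have : b = a := by simpa [coeff_monomial, eq_comm] using hb
    exact ⟨_, ⟨f, hf, h0, rfl⟩, this ▸ hle⟩

theorem degree_X_sub_one {K : Type*} [Field K] (ord : MonomialOrder σ) (v : σ) :
    ord.degree (X v - 1 : MvPolynomial σ K) = Finsupp.single v 1 := by
  simpa using ord.degree_X_sub_C v (1 : K)

/-- `g` is one of `x_v x_w` with `v ≠ w`, `x_v (x_v - 1)`, `x_v`, or `x_v - 1` with `v ∈ O`. -/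
def IsSimpleGen (O : Set σ) (g : MvPolynomial σ (ZMod 2)) : Prop :=
  (∃ v w, v ≠ w ∧ g = X v * X w) ∨ (∃ v, g = X v * (X v - 1)) ∨ (∃ v, g = X v) ∨
    ∃ v ∈ O, g = X v - 1

/-- The exponent of the squarefree monomial with support `A`. -/
noncomputable def squarefreeExp (A : Finset σ) : σ →₀ ℕ := ∑ v ∈ A, Finsupp.single v 1

theorem degree_squarefreeExp (A : Finset σ) : (squarefreeExp A).degree = A.card := by
  rw [squarefreeExp, map_sum]; simp

theorem monomial_squarefreeExp {R : Type*} [CommSemiring R] (A : Finset σ) :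
    monomial (squarefreeExp A) (1 : R) = ∏ v ∈ A, X v := by
  rw [squarefreeExp, monomial_sum_one]; rfl

variable [DecidableEq σ]

/-- The `0/1` point whose coordinates equal to `1` are those in `P`. -/
def indicatorPoint (P : Finset σ) : σ → ZMod 2 := fun v => if v ∈ P then 1 else 0

theorem squarefreeExp_apply (A : Finset σ) (v : σ) :
    squarefreeExp A v = if v ∈ A then 1 else 0 := by
  simp [squarefreeExp, Finsupp.finsetSum_apply, Finsupp.single_apply]

theorem support_squarefreeExp (A : Finset σ) : (squarefreeExp A).support = A := by
  ext v; simp [squarefreeExp_apply]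

theorem squarefreeExp_injective : Function.Injective (squarefreeExp (σ := σ)) := fun A B h => by
  rw [← support_squarefreeExp A, h, support_squarefreeExp]

theorem eq_squarefreeExp_of_le {A : Finset σ} {b : σ →₀ ℕ} (h : b ≤ squarefreeExp A) :
    b = squarefreeExp b.support := by
  ext v
  have := h v
  rw [squarefreeExp_apply] at this ⊢
  by_cases hv : b v = 0
  · simp [hv]
  · rw [if_pos (Finsupp.mem_support_iff.2 hv)]
    split_ifs at this <;> omega

theorem squarefreeExp_support_le (d : σ →₀ ℕ) : squarefreeExp d.support ≤ d := fun v => by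
  rw [squarefreeExp_apply]
  split_ifs with h
  · exact Nat.one_le_iff_ne_zero.2 (Finsupp.mem_support_iff.1 h)
  · exact Nat.zero_le _

theorem aeval_indicatorPoint_monomial (P : Finset σ) (d : σ →₀ ℕ) (c : ZMod 2) :
    aeval (indicatorPoint P) (monomial d c) = if d.support ⊆ P then c else 0 := by
  rw [aeval_monomial, Finsupp.prod]
  split_ifs with h
  · rw [Finset.prod_eq_one]
    · simp
    · intro v hv
      simp [indicatorPoint, h hv]
  · obtain ⟨v, hv, hvP⟩ := Finset.not_subset.1 h
    rw [Finset.prod_eq_zero hv, mul_zero]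
    simp [indicatorPoint, hvP, Finsupp.mem_support_iff.1 hv]

/-- Möbius inversion over `𝔽₂`: summing the values of `f` at the points `C ∪ O` with `C ⊆ A`
extracts the coefficients of the monomials whose support is `A` outside `O`. -/
theorem sum_powerset_aeval_indicatorPoint (f : MvPolynomial σ (ZMod 2)) (A O : Finset σ) :
    ∑ C ∈ A.powerset, aeval (indicatorPoint (C ∪ O)) f =
      ∑ d ∈ f.support, if d.support \ O = A then f.coeff d else 0 := by
  have key : ∀ (d : σ →₀ ℕ) (c : ZMod 2),
      (∑ C ∈ A.powerset, if d.support ⊆ C ∪ O then c else 0) =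
        if d.support \ O = A then c else 0 := by
    intro d c
    rw [← Finset.sum_filter, Finset.sum_const]
    -- These `C` form a Boolean interval of size a power of two, which is even unless the interval
    -- is a single point.
    have hI : {C ∈ A.powerset | d.support ⊆ C ∪ O} = Finset.Icc (d.support \ O) A := by
      ext C
      rw [Finset.mem_filter, Finset.mem_powerset, Finset.mem_Icc, Finset.union_comm, and_comm,
        ← Finset.sup_eq_union, ← sdiff_le_iff]
    rw [hI]
    split_ifs with h
    · simp [h]
    · by_cases hs : d.support \ O ⊆ A
      · rw [Finset.card_Icc_finset hs]
        have hlt := Finset.card_lt_card (hs.ssubset_of_ne h)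
        obtain ⟨e, he⟩ := Nat.exists_eq_add_of_lt hlt
        rw [he, show (d.support \ O).card + e + 1 - (d.support \ O).card = e + 1 by omega,
          pow_succ, mul_nsmul, two_nsmul, CharTwo.add_self_eq_zero]
      · rw [Finset.Icc_eq_empty (by simpa using hs)]; simp
  calc _ = ∑ C ∈ A.powerset, ∑ d ∈ f.support,
        if d.support ⊆ C ∪ O then f.coeff d else 0 := by
        refine Finset.sum_congr rfl fun C _ => ?_
        conv_lhs => rw [f.as_sum, map_sum]
        simp only [aeval_indicatorPoint_monomial]
    _ = _ := by
        rw [Finset.sum_comm]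
        exact Finset.sum_congr rfl fun d _ => key d _

/-- Suppose `f ∈ I` has leading exponent `b ≤ A`. Summing `f` over the zeros `C ∪ O`, `C ⊆ supp b`,
gives `0`. By Möbius inversion only monomials with support `supp b` outside `O` contribute; they are
multiples of `x^b`, so all but `x^b` exceed the leading monomial. The leading coefficient would be
`0`. -/
theorem squarefreeExp_notMem_initialIdeal (ord : MonomialOrder σ)
    {I : Ideal (MvPolynomial σ (ZMod 2))} {A O : Finset σ} (hAO : Disjoint A O)
    (hV : ∀ C ⊆ A, indicatorPoint (C ∪ O) ∈ zeroLocus (ZMod 2) I) :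
    monomial (squarefreeExp A) (1 : ZMod 2) ∉ initialIdeal ord I := by
  rw [monomial_mem_initialIdeal]
  rintro ⟨f, hf, h0, hle⟩
  set b := ord.degree f with hb
  have hbs := eq_squarefreeExp_of_le hle
  have hsub : b.support ⊆ A := by
    simpa [support_squarefreeExp] using Finsupp.support_mono hle
  have hdis : b.support \ O = b.support :=
    Finset.sdiff_eq_self_of_disjoint (hAO.mono_left hsub)
  have hsum := sum_powerset_aeval_indicatorPoint f b.support O
  rw [Finset.sum_eq_zero fun C hC => hV C ((Finset.mem_powerset.1 hC).trans hsub) f hf,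
    Finset.sum_eq_single b] at hsum
  · rw [if_pos hdis] at hsum
    exact h0 (ord.leadingCoeff_eq_zero_iff.1 hsum.symm)
  · intro d hd hdb
    split_ifs with h
    · have hbd : b ≤ d := by
        rw [hbs]
        refine le_trans (fun v => ?_) (squarefreeExp_support_le d)
        rw [squarefreeExp_apply, squarefreeExp_apply]
        by_cases hv : v ∈ b.support
        · have : v ∈ d.support := Finset.sdiff_subset (h ▸ hv)
          simp only [if_pos hv, if_pos this, le_refl]
        · simp only [if_neg hv, zero_le]
      exact ord.coeff_eq_zero_of_lt (ord.toSyn_strictMono (lt_of_le_of_ne hbd (Ne.symm hdb)))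
    · rfl
  · intro h
    rw [notMem_support_iff.1 h, ite_self]

theorem prod_X_mem_of_union {R : Type*} [CommRing R] {I : Ideal (MvPolynomial σ R)}
    {A O : Finset σ} (hO : ∀ v ∈ O, (X v - 1 : MvPolynomial σ R) ∈ I)
    (h : ∏ v ∈ A ∪ O, (X v : MvPolynomial σ R) ∈ I) : ∏ v ∈ A, (X v : MvPolynomial σ R) ∈ I := by
  rw [← Finset.union_sdiff_self_eq_union, Finset.prod_union Finset.disjoint_sdiff] at h
  rw [← Ideal.Quotient.eq_zero_iff_mem] at h ⊢
  rw [map_mul, map_prod (Ideal.Quotient.mk I) _ (O \ A)] at h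
  rwa [Finset.prod_eq_one (s := O \ A), mul_one] at h
  · intro v hv
    have := Ideal.Quotient.eq_zero_iff_mem.2 (hO v (Finset.mem_sdiff.1 hv).1)
    rwa [map_sub, map_one, sub_eq_zero] at this

/-- Standard monomials of an ideal over `𝔽₂` that contains the field equations, the equations
`x_v = 1` for `v ∈ O`, and every squarefree monomial (divisible by those of `O`) that is not
the support of a zero, when the set of zeros is closed under removing elements outside `O`. -/
theorem hilbertFunction_eq_ncard (ord : MonomialOrder σ) (I : Ideal (MvPolynomial σ (ZMod 2)))
    (O : Finset σ) (hsq : ∀ v, (X v * (X v - 1) : MvPolynomial σ (ZMod 2)) ∈ I)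
    (hO : ∀ v ∈ O, (X v - 1 : MvPolynomial σ (ZMod 2)) ∈ I)
    (hmem : ∀ P, O ⊆ P → indicatorPoint P ∉ zeroLocus (ZMod 2) I →
      ∏ v ∈ P, (X v : MvPolynomial σ (ZMod 2)) ∈ I)
    (hdown : ∀ P Q, O ⊆ Q → Q ⊆ P → indicatorPoint P ∈ zeroLocus (ZMod 2) I →
      indicatorPoint Q ∈ zeroLocus (ZMod 2) I) (m : ℕ) :
    hilbertFunction ord I m =
      {P : Finset σ | P.card = m + O.card ∧ indicatorPoint P ∈ zeroLocus (ZMod 2) I}.ncard := by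
  have hstd : standardMonomials ord I m = squarefreeExp ''
      {A | A.card = m ∧ Disjoint A O ∧ indicatorPoint (A ∪ O) ∈ zeroLocus (ZMod 2) I} := by
    ext a
    constructor
    · rintro ⟨hdeg, hin⟩
      rw [monomial_mem_initialIdeal] at hin
      push Not at hin
      have hX : ∀ v, (X v - 1 : MvPolynomial σ (ZMod 2)) ≠ 0 := fun v h => by
        have := degree_X_sub_one (K := ZMod 2) ord v
        rw [h, ord.degree_zero] at this
        simpa using DFunLike.congr_fun this v
      -- `a` is squarefree because `x_v²` is the leading monomial of `x_v(x_v - 1) ∈ I`.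
      have ha : a ≤ squarefreeExp a.support := by
        intro v
        by_contra hv
        have hX0 : (X v : MvPolynomial σ (ZMod 2)) ≠ 0 := X_ne_zero v
        refine hin _ (hsq v) (mul_ne_zero hX0 (hX v)) ?_
        rw [ord.degree_mul hX0 (hX v), ord.degree_X, degree_X_sub_one, ← Finsupp.single_add,
          Finsupp.single_le_iff]
        rw [squarefreeExp_apply] at hv
        split_ifs at hv with h
        · omega
        · simp only [Finsupp.mem_support_iff, not_not] at h
          omega
      have ha' := eq_squarefreeExp_of_le ha
      refine ⟨a.support, ⟨?_, ?_, ?_⟩, ha'.symm⟩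
      · rw [← degree_squarefreeExp, ← ha', hdeg]
      · rw [Finset.disjoint_left]
        intro v hv hvO
        refine hin _ (hO v hvO) (hX v) ?_
        rw [degree_X_sub_one, Finsupp.single_le_iff]
        exact Nat.one_le_iff_ne_zero.2 (Finsupp.mem_support_iff.1 hv)
      · by_contra hV
        have := prod_X_mem_of_union hO (hmem _ Finset.subset_union_right hV)
        rw [← monomial_squarefreeExp] at this
        refine hin _ this (by simp) ?_
        rw [ord.degree_monomial, if_neg one_ne_zero]
        exact squarefreeExp_support_le a
    · rintro ⟨A, ⟨hc, hd, hV⟩, rfl⟩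
      exact ⟨by rw [degree_squarefreeExp, hc], squarefreeExp_notMem_initialIdeal ord hd
        fun C hC => hdown _ _ Finset.subset_union_right (Finset.union_subset_union_left hC) hV⟩
  -- Every zero contains `O`, so `P ↦ P \ O` inverts `A ↦ A ∪ O`.
  have hsubO : ∀ P, indicatorPoint P ∈ zeroLocus (ZMod 2) I → O ⊆ P := by
    intro P hP v hv
    by_contra hvP
    simpa [indicatorPoint, hvP] using hP _ (hO v hv)
  rw [hilbertFunction, hstd, Set.ncard_image_of_injective _ squarefreeExp_injective]
  refine Set.ncard_congr (fun A _ => A ∪ O) ?_ ?_ ?_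
  · rintro A ⟨hc, hd, hV⟩
    exact ⟨by rw [Finset.card_union_of_disjoint hd, hc], hV⟩
  · rintro A B ⟨_, hA, _⟩ ⟨_, hB, _⟩ h
    rw [← Finset.union_sdiff_cancel_right hA, ← Finset.union_sdiff_cancel_right hB, h]
  · rintro P ⟨hc, hV⟩
    have hOP := hsubO P hV
    refine ⟨P \ O, ⟨?_, Finset.sdiff_disjoint, ?_⟩, Finset.sdiff_union_of_subset hOP⟩
    · rw [Finset.card_sdiff_of_subset hOP, hc, Nat.add_sub_cancel]
    · rwa [Finset.sdiff_union_of_subset hOP]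

/-- At `P ⊇ O` only a monomial generator can fail to vanish, and it then divides `∏ v ∈ P, X v`.
Shrinking `P` while keeping `O` preserves the vanishing of every generator. -/
theorem hilbertFunction_span_eq_ncard [Finite σ] (ord : MonomialOrder σ)
    (G : Set (MvPolynomial σ (ZMod 2))) (O : Set σ)
    (hG : ∀ g ∈ G, IsSimpleGen O g)
    (hsq : ∀ v, (X v * (X v - 1) : MvPolynomial σ (ZMod 2)) ∈ G)
    (hO : ∀ v ∈ O, (X v - 1 : MvPolynomial σ (ZMod 2)) ∈ G) (m : ℕ) :
    hilbertFunction ord (Ideal.span G) m =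
      {P : Finset σ | P.card = m + O.ncard ∧
        indicatorPoint P ∈ zeroLocus (ZMod 2) (Ideal.span G)}.ncard := by
  obtain ⟨O, rfl⟩ := (Set.toFinite O).exists_finset_coe
  rw [Set.ncard_coe_finset]
  refine hilbertFunction_eq_ncard ord _ O (fun v => Ideal.subset_span (hsq v))
    (fun v hv => Ideal.subset_span (hO v hv)) ?_ ?_ m
  · intro P hOP hP
    rw [zeroLocus_span] at hP
    simp only [Set.mem_ofPred_eq, not_forall] at hP
    obtain ⟨g, hg, hgP⟩ := hP
    have hg' := Ideal.subset_span (α := MvPolynomial σ (ZMod 2)) hg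
    rcases hG g hg with ⟨v, w, hvw, rfl⟩ | ⟨v, rfl⟩ | ⟨v, rfl⟩ | ⟨v, hv, rfl⟩
    · have hvP : v ∈ P := by by_contra h; simp [indicatorPoint, h] at hgP
      have hwP : w ∈ P := by by_contra h; simp [indicatorPoint, h] at hgP
      refine Ideal.mem_of_dvd _ ?_ hg'
      rw [← Finset.prod_pair (f := fun v => (X v : MvPolynomial σ (ZMod 2))) hvw]
      exact Finset.prod_dvd_prod_of_subset _ _ _ (by simp [Finset.insert_subset_iff, hvP, hwP])
    · by_cases h : v ∈ P <;> simp [indicatorPoint, h] at hgP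
    · have hvP : v ∈ P := by by_contra h; simp [indicatorPoint, h] at hgP
      exact Ideal.mem_of_dvd _ (Finset.dvd_prod_of_mem _ hvP) hg'
    · simp [indicatorPoint, hOP (Finset.mem_coe.1 hv)] at hgP
  · intro P Q hOQ hQP hP
    rw [zeroLocus_span] at hP ⊢
    intro g hg
    have hgP := hP g hg
    rcases hG g hg with ⟨v, w, hvw, rfl⟩ | ⟨v, rfl⟩ | ⟨v, rfl⟩ | ⟨v, hv, rfl⟩
    · by_cases hv : v ∈ Q
      · by_cases hw : w ∈ Q
        · simp [indicatorPoint, hQP hv, hQP hw] at hgP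
        · simp [indicatorPoint, hw]
      · simp [indicatorPoint, hv]
    · by_cases h : v ∈ Q <;> simp [indicatorPoint, h]
    · by_cases hv : v ∈ Q
      · simp [indicatorPoint, hQP hv] at hgP
      · simp [indicatorPoint, hv]
    · simp [indicatorPoint, hOQ (Finset.mem_coe.1 hv)]

end

/-! ### Zeros and generators of the partial Latin rectangle ideals -/

section

variable {r s n : ℕ}

theorem isSimpleGen_of_mem_rowGens {i : Fin r} {p : Poly r s n} (O : Set (Idx r s n))
    (hp : p ∈ rowGens r s n i) : IsSimpleGen O p := by
  rcases hp with (⟨j, j', k, h, rfl⟩ | ⟨j, k, k', h, rfl⟩) | ⟨j, k, rfl⟩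
  · exact Or.inl ⟨_, _, by simpa using h, rfl⟩
  · exact Or.inl ⟨_, _, by simpa using h, rfl⟩
  · exact Or.inr (Or.inl ⟨_, rfl⟩)

theorem isSimpleGen_of_mem_colGens {p : Poly r s n} (O : Set (Idx r s n))
    (hp : p ∈ colGens r s n) : IsSimpleGen O p := by
  obtain ⟨i, i', j, k, h, rfl⟩ := hp
  exact Or.inl ⟨_, _, by simpa using h, rfl⟩

theorem hilbertFunction_plrIdeal (ord : MonomialOrder (Idx r s n)) (m : ℕ) :
    hilbertFunction ord (plrIdeal r s n) m =
      {P : Finset (Idx r s n) | P.card = m ∧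
        indicatorPoint P ∈ zeroLocus (ZMod 2) (plrIdeal r s n)}.ncard := by
  have := hilbertFunction_span_eq_ncard ord ((⋃ i, rowGens r s n i) ∪ colGens r s n) ∅
    (by
      rintro g (hg | hg)
      · obtain ⟨i, hi⟩ := Set.mem_iUnion.1 hg
        exact isSimpleGen_of_mem_rowGens _ hi
      · exact isSimpleGen_of_mem_colGens _ hg)
    (fun v => Or.inl (Set.mem_iUnion.2 ⟨v.1, Or.inr ⟨v.2.1, v.2.2, rfl⟩⟩))
    (by simp) m
  simpa [plrIdeal] using this

theorem toRow_X (i : Fin r) (v : Idx r s n) :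
    toRow i (X v : Poly r s n) = X (i, v.2) := rename_X _ _

theorem toRow_image_rowGens (i i' : Fin r) :
    toRow i '' rowGens r s n i' = rowGens r s n i := by
  ext p
  constructor
  · rintro ⟨_, (⟨j, j', k, h, rfl⟩ | ⟨j, k, k', h, rfl⟩) | ⟨j, k, rfl⟩, rfl⟩
    · exact Or.inl (Or.inl ⟨j, j', k, h, by simp [toRow_X]⟩)
    · exact Or.inl (Or.inr ⟨j, k, k', h, by simp [toRow_X]⟩)
    · exact Or.inr ⟨j, k, by simp [toRow_X]⟩
  · rintro ((⟨j, j', k, h, rfl⟩ | ⟨j, k, k', h, rfl⟩) | ⟨j, k, rfl⟩)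
    · exact ⟨_, Or.inl (Or.inl ⟨j, j', k, h, rfl⟩), by simp [toRow_X]⟩
    · exact ⟨_, Or.inl (Or.inr ⟨j, k, k', h, rfl⟩), by simp [toRow_X]⟩
    · exact ⟨_, Or.inr ⟨j, k, rfl⟩, by simp [toRow_X]⟩

theorem aeval_toRow (i : Fin r) (x : Idx r s n → ZMod 2) (p : Poly r s n) :
    aeval x (toRow i p) = aeval (fun v : Idx r s n => x (i, v.2)) p :=
  aeval_rename _ _ _

variable [NeZero r] {t : ℕ} (T : Fin t → List (Poly r s n))

theorem rowGens_subset_partGens (i : Fin r) (l : Fin t) :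
    rowGens r s n i ⊆ partGens T i l := by
  rw [← toRow_image_rowGens i 0]
  exact Set.image_mono Set.subset_union_left

theorem tupleIdeal_eq_span (τ : Fin r → Fin t) :
    tupleIdeal T τ = Ideal.span ((⋃ i, partGens T i (τ i)) ∪ colGens r s n) := by
  rw [Ideal.span_union, Ideal.span_iUnion, tupleIdeal, Ideal.sum_eq_sup, Finset.sup_univ_eq_iSup]
  rfl

/-- Evaluating a renamed polynomial at `x` is evaluating the original at the point that repeats row
`i` of `x` in every row; this transfers the row conditions to the first row. -/
theorem mem_zeroLocus_plrIdeal (x : Idx r s n → ZMod 2) :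
    x ∈ zeroLocus (ZMod 2) (plrIdeal r s n) ↔
      (∀ i : Fin r, (fun v : Idx r s n => x (i, v.2)) ∈
        zeroLocus (ZMod 2) (rowIdeal r s n 0)) ∧ ∀ p ∈ colGens r s n, aeval x p = 0 := by
  simp only [plrIdeal, rowIdeal, zeroLocus_span, Set.mem_ofPred_eq, Set.mem_union, Set.mem_iUnion,
    or_imp, forall_and, forall_exists_index]
  refine and_congr_left fun _ => ?_
  rw [forall_comm]
  refine forall_congr' fun i => ?_
  rw [← toRow_image_rowGens i 0]
  simp only [Set.forall_mem_image, aeval_toRow]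

theorem mem_zeroLocus_tupleIdeal (τ : Fin r → Fin t) (x : Idx r s n → ZMod 2) :
    x ∈ zeroLocus (ZMod 2) (tupleIdeal T τ) ↔
      (∀ i : Fin r, (fun v : Idx r s n => x (i, v.2)) ∈
        zeroLocus (ZMod 2) (firstRowPart T (τ i))) ∧ ∀ p ∈ colGens r s n, aeval x p = 0 := by
  simp only [tupleIdeal_eq_span, firstRowPart, zeroLocus_span, Set.mem_ofPred_eq, Set.mem_union,
    Set.mem_iUnion, or_imp, forall_and, forall_exists_index]
  refine and_congr_left fun _ => ?_
  rw [forall_comm]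
  refine forall_congr' fun i => ?_
  simp only [partGens, Set.forall_mem_image, aeval_toRow]

variable {T}

theorem existsUnique_mem_zeroLocus_tupleIdeal (hT : IsTriangularDecomposition T)
    (x : Idx r s n → ZMod 2) (hx : x ∈ zeroLocus (ZMod 2) (plrIdeal r s n)) :
    ∃! τ : Fin r → Fin t, x ∈ zeroLocus (ZMod 2) (tupleIdeal T τ) := by
  obtain ⟨hrow, hcol⟩ := (mem_zeroLocus_plrIdeal x).1 hx
  simp only [← hT.covers, Set.mem_iUnion] at hrow
  choose τ hτ using hrow
  refine ⟨τ, (mem_zeroLocus_tupleIdeal T τ x).2 ⟨hτ, hcol⟩, fun τ' hτ' => funext fun i => ?_⟩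
  by_contra hne
  exact Set.disjoint_left.1 (hT.disjoint hne)
    (((mem_zeroLocus_tupleIdeal T τ' x).1 hτ').1 i) (hτ i)

theorem mem_zeroLocus_plrIdeal_of_tupleIdeal (τ : Fin r → Fin t) {x : Idx r s n → ZMod 2}
    (hx : x ∈ zeroLocus (ZMod 2) (tupleIdeal T τ)) : x ∈ zeroLocus (ZMod 2) (plrIdeal r s n) := by
  refine zeroLocus_anti_mono ?_ hx
  rw [tupleIdeal_eq_span]
  exact Ideal.span_mono (Set.union_subset_union_left _
    (Set.iUnion_mono fun i => rowGens_subset_partGens T i (τ i)))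

/-- The variables set to `1` by the generators of `K_{τ(1),…,τ(r)}`. -/
def unitVars (T : Fin t → List (Poly r s n)) (τ : Fin r → Fin t) : Set (Idx r s n) :=
  {v | (X v - 1 : Poly r s n) ∈ (⋃ i, partGens T i (τ i)) ∪ colGens r s n}

theorem numOnes_eq_ncard_unitVars (τ : Fin r → Fin t) : numOnes T τ = (unitVars T τ).ncard := by
  have hinj : Function.Injective fun v : Idx r s n => (X v - 1 : Poly r s n) :=
    fun v w h => X_injective (sub_left_injective h)
  rw [← Set.ncard_image_of_injective _ hinj, numOnes]
  congr 1
  ext p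
  constructor
  · rintro ⟨hp, v, rfl⟩
    exact ⟨v, hp, rfl⟩
  · rintro ⟨v, hv, rfl⟩
    exact ⟨hv, v, rfl⟩

/-- A system member in `I^{(1)}` is renamed into the span of the generators of row `i`, so it is
redundant unless it is itself simple. All generators `x_v - 1` survive, so `O` is still counted by
`numOnes`. -/
theorem tupleIdeal_eq_span_isSimpleGen (hT : IsTriangularDecomposition T) (τ : Fin r → Fin t) :
    tupleIdeal T τ = Ideal.span {g | g ∈ (⋃ i, partGens T i (τ i)) ∪ colGens r s n ∧
      IsSimpleGen (unitVars T τ) g} := by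
  rw [tupleIdeal_eq_span]
  refine le_antisymm (Ideal.span_le.2 ?_) (Ideal.span_mono fun g hg => hg.1)
  rintro g (hg | hg)
  · obtain ⟨i, p, hp | hp, rfl⟩ := Set.mem_iUnion.1 hg
    · exact Ideal.subset_span ⟨Or.inl hg, isSimpleGen_of_mem_rowGens (i := i) _
        (toRow_image_rowGens i 0 ▸ Set.mem_image_of_mem _ hp)⟩
    · rcases hT.form _ p hp with ⟨v, rfl⟩ | ⟨v, rfl⟩ | hp
      · exact Ideal.subset_span ⟨Or.inl hg, Or.inr (Or.inr (Or.inl ⟨_, toRow_X i v⟩))⟩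
      · have h : toRow i (X v - 1 : Poly r s n) = X (i, v.2) - 1 := by
          rw [map_sub, toRow_X, map_one]
        refine Ideal.subset_span ⟨Or.inl hg, Or.inr (Or.inr (Or.inr ⟨(i, v.2), ?_, h⟩))⟩
        rw [unitVars, Set.mem_ofPred_eq, ← h]
        exact Or.inl hg
      · have h := Ideal.mem_map_of_mem (toRow i) hp
        rw [rowIdeal, Ideal.map_span, toRow_image_rowGens] at h
        refine Ideal.span_le.2 (fun q hq => ?_) h
        exact Ideal.subset_span
          ⟨Or.inl (Set.mem_iUnion.2 ⟨i, rowGens_subset_partGens T i (τ i) hq⟩),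
            isSimpleGen_of_mem_rowGens _ hq⟩
  · exact Ideal.subset_span ⟨Or.inr hg, isSimpleGen_of_mem_colGens _ hg⟩

theorem unitVars_subset (τ : Fin r → Fin t) {P : Finset (Idx r s n)}
    (hP : indicatorPoint P ∈ zeroLocus (ZMod 2) (tupleIdeal T τ)) : unitVars T τ ⊆ P := by
  intro v hv
  by_contra hvP
  rw [tupleIdeal_eq_span] at hP
  simpa [indicatorPoint, show v ∉ P from hvP] using hP _ (Ideal.subset_span hv)

theorem hilbertFunction_tupleIdeal (hT : IsTriangularDecomposition T)
    (ord : MonomialOrder (Idx r s n)) (τ : Fin r → Fin t) (m : ℕ) :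
    hilbertFunction ord (tupleIdeal T τ) m =
      {P : Finset (Idx r s n) | P.card = m + numOnes T τ ∧
        indicatorPoint P ∈ zeroLocus (ZMod 2) (tupleIdeal T τ)}.ncard := by
  rw [tupleIdeal_eq_span_isSimpleGen hT, numOnes_eq_ncard_unitVars]
  refine hilbertFunction_span_eq_ncard ord _ _ (fun g hg => hg.2) (fun v => ?_) (fun v hv => ?_) m
  · exact ⟨Or.inl (Set.mem_iUnion.2 ⟨v.1, rowGens_subset_partGens T _ _
      (Or.inr ⟨v.2.1, v.2.2, rfl⟩)⟩), Or.inr (Or.inl ⟨v, rfl⟩)⟩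
  · exact ⟨hv, Or.inr (Or.inr (Or.inr ⟨v, hv, rfl⟩))⟩

end

end LatinRect

/-! ### Counting zeros with `m` ones -/

theorem mainTheorem9 (r s n : ℕ) [NeZero r] (ord : MonomialOrder (LatinRect.Idx r s n))
    (t : ℕ) (T : Fin t → List (LatinRect.Poly r s n))
    (hT : LatinRect.IsTriangularDecomposition T) (m : ℕ) :
    LatinRect.hilbertFunction ord (LatinRect.plrIdeal r s n) m =
      ∑ τ : Fin r → Fin t with LatinRect.numOnes T τ ≤ m,
        LatinRect.hilbertFunction ord (LatinRect.tupleIdeal T τ) (m - LatinRect.numOnes T τ) := by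
  classical
  -- Tuples with `m_τ > m` have no zero with `m` ones, so restricting the sum loses nothing.
  have hle : ∀ (τ : Fin r → Fin t) (P : Finset (LatinRect.Idx r s n)),
      LatinRect.indicatorPoint P ∈ zeroLocus (ZMod 2) (LatinRect.tupleIdeal T τ) →
        LatinRect.numOnes T τ ≤ P.card := fun τ P hP => by
    rw [LatinRect.numOnes_eq_ncard_unitVars, ← Set.ncard_coe_finset]
    exact Set.ncard_le_ncard (LatinRect.unitVars_subset τ hP)
  rw [LatinRect.hilbertFunction_plrIdeal]
  have hterm : ∀ τ ∈ Finset.univ.filter fun τ : Fin r → Fin t => LatinRect.numOnes T τ ≤ m,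
      LatinRect.hilbertFunction ord (LatinRect.tupleIdeal T τ) (m - LatinRect.numOnes T τ) =
        (Finset.univ.filter fun P : Finset (LatinRect.Idx r s n) => P.card = m ∧
          LatinRect.indicatorPoint P ∈
            zeroLocus (ZMod 2) (LatinRect.tupleIdeal T τ)).card := fun τ hτ => by
    rw [LatinRect.hilbertFunction_tupleIdeal hT,
      Nat.sub_add_cancel (Finset.mem_filter.1 hτ).2, ← Set.ncard_coe_finset]
    simp
  rw [Finset.sum_congr rfl hterm, ← Finset.card_biUnion, ← Set.ncard_coe_finset]
  · congr 1
    ext P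
    simp only [Set.mem_ofPred_eq, Finset.coe_biUnion, Finset.coe_filter, Finset.mem_univ, true_and,
      Set.mem_iUnion, exists_prop]
    constructor
    · rintro ⟨hc, hP⟩
      obtain ⟨τ, hτ, -⟩ := LatinRect.existsUnique_mem_zeroLocus_tupleIdeal hT _ hP
      exact ⟨τ, hc ▸ hle τ P hτ, hc, hτ⟩
    · rintro ⟨τ, -, hc, hτ⟩
      exact ⟨hc, LatinRect.mem_zeroLocus_plrIdeal_of_tupleIdeal τ hτ⟩
  · intro τ _ τ' _ hne
    rw [Function.onFun, Finset.disjoint_left]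
    intro P hP hP'
    have h := (Finset.mem_filter.1 hP).2.2
    exact hne ((LatinRect.existsUnique_mem_zeroLocus_tupleIdeal hT _
      (LatinRect.mem_zeroLocus_plrIdeal_of_tupleIdeal τ h)).unique h
        (Finset.mem_filter.1 hP').2.2)
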